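/- Let $\mathbb K\in\{\mathbb R,\mathbb C\}$; all functions are $\mathbb K$-valued. For $g\in L^1(\mathbb R)$ let $Hg(x)=\frac1\pi\,\mathrm{p.v.}\int_{\mathbb R}\frac{g(y)}{x-y}\,dy$ be its Hilbert transform, and let $H^1(\mathbb R)=\{g\in L^1(\mathbb R): Hg\in L^1(\mathbb R)\}$ be the real-variable Hardy space with the norm $\|g\|_{H^1}=\|g\|_1+\|Hg\|_1$. Let $L^\infty(\mathbb R)\hat\otimes_\pi H^1(\mathbb R)$ be the completed projective tensor product, that is, the completion of the algebraic tensor product in the norm $\|u\|_\pi=\inf\{\sum_i\|f_i\|_\infty\|g_i\|_{H^1}: u=\sum_i f_i\otimes g_i\}$ (finite sums). Let $\mu$ be a Borel measure on $\mathbb R^2$ for which the coordinate axes are null sets (for example, Lebesgue measure). A Banach lattice of measurable functions on $\mathbb R^2$ is a linear subspace $E$ of the space of $\mu$-a.e. classes of measurable functions, with a complete norm $\|\cdot\|_E$, such that if $g\in E$, $f$ is measurable and $|f|\le|g|$ a.e., then $f\in E$ and $\|f\|_E\le\|g\|_E$. Define $$(\mathbf Kf)(x_1,x_2)=\frac1\pi\int_{\mathbb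 R}\left(\mathrm{p.v.}\int_{\mathbb R}\frac{f(y_1,y_2)}{x_1y_2-x_2y_1}\,dy_2\right)dy_1 .$$ **Theorem.** Let $E$ be a Banach lattice of measurable functions on $\mathbb R^2$ which contains the function $w(x_1,x_2)=|x_2|^{-1}$. Then for every $f(y_1,y_2)=\sum_{i=1}^n f_i(y_1)g_i(y_2)$ with $f_i\in L^\infty(\mathbb R)$ and $g_i\in H^1(\mathbb R)$ the function $\mathbf Kf$ is defined $\mu$-almost everywhere (the inner integral as a principal value for almost every $y_1$, the outer one absolutely convergent) and belongs to $E$, and $\mathbf K$ extends from such functions to a unique bounded linear operator $$\mathbf K: L^\infty(\mathbb R)\hat\otimes_\pi H^1(\mathbb R)\to E,\qquad \|\mathbf K\|_{L^\infty(\mathbb R)\hat\otimes_\pi H^1(\mathbb R)\to E}\le\|w\|_E .$$ -/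

import Mathlib

open MeasureTheory Filter Topology
open scoped TensorProduct ENNReal

noncomputable section

/-! ### Projective tensor product of two normed spaces -/

section Projective

variable (𝕜 : Type*) [RCLike 𝕜] (A B : Type*) [NormedAddCommGroup A] [NormedSpace 𝕜 A]
  [NormedAddCommGroup B] [NormedSpace 𝕜 B]

variable {A B} in
/-- The costs `∑ ‖aᵢ‖ ‖bᵢ‖` of all finite representations `u = ∑ aᵢ ⊗ bᵢ`. -/
def projCosts (u : A ⊗[𝕜] B) : Set ℝ :=
  {r | ∃ (n : ℕ) (a : Fin n → A) (b : Fin n → B),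
    u = ∑ i, a i ⊗ₜ[𝕜] b i ∧ r = ∑ i, ‖a i‖ * ‖b i‖}

variable {𝕜 A B} in
theorem projCosts_nonneg {u : A ⊗[𝕜] B} {r : ℝ} (hr : r ∈ projCosts 𝕜 u) : 0 ≤ r := by
  obtain ⟨n, a, b, -, rfl⟩ := hr
  positivity

variable {𝕜 A B} in
theorem projCosts_bddBelow (u : A ⊗[𝕜] B) : BddBelow (projCosts 𝕜 u) :=
  ⟨0, fun _ hr => projCosts_nonneg hr⟩

variable {𝕜 A B} in
theorem projCosts_add {u v : A ⊗[𝕜] B} {r s : ℝ} (hr : r ∈ projCosts 𝕜 u)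
    (hs : s ∈ projCosts 𝕜 v) : r + s ∈ projCosts 𝕜 (u + v) := by
  obtain ⟨n, a, b, rfl, rfl⟩ := hr
  obtain ⟨m, c, d, rfl, rfl⟩ := hs
  refine ⟨n + m, Fin.append a c, Fin.append b d, ?_, ?_⟩ <;> simp [Fin.sum_univ_add]

variable {𝕜 A B} in
theorem projCosts_smul {u : A ⊗[𝕜] B} {r : ℝ} (k : 𝕜) (hr : r ∈ projCosts 𝕜 u) :
    ‖k‖ * r ∈ projCosts 𝕜 (k • u) := by
  obtain ⟨n, a, b, rfl, rfl⟩ := hr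
  refine ⟨n, fun i => k • a i, b, ?_, ?_⟩
  · simp [Finset.smul_sum, TensorProduct.smul_tmul']
  · simp [Finset.mul_sum, norm_smul, mul_assoc]

variable {𝕜 A B} in
theorem projCosts_nonempty (u : A ⊗[𝕜] B) : (projCosts 𝕜 u).Nonempty := by
  induction u using TensorProduct.induction_on with
  | zero => exact ⟨0, 0, Fin.elim0, Fin.elim0, by simp, by simp⟩
  | tmul x y => exact ⟨‖x‖ * ‖y‖, 1, fun _ => x, fun _ => y, by simp, by simp⟩
  | add u v hu hv =>
    obtain ⟨r, hr⟩ := hu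
    obtain ⟨s, hs⟩ := hv
    exact ⟨r + s, projCosts_add hr hs⟩

/-- The projective (semi)norm `‖u‖_π = inf {∑ ‖aᵢ‖ ‖bᵢ‖ : u = ∑ aᵢ ⊗ bᵢ}` on `A ⊗ B`. -/
def projSeminorm : Seminorm 𝕜 (A ⊗[𝕜] B) :=
  Seminorm.ofSMulLE (fun u => sInf (projCosts 𝕜 u))
    (le_antisymm
      (csInf_le (projCosts_bddBelow _) ⟨0, Fin.elim0, Fin.elim0, by simp, by simp⟩)
      (Real.sInf_nonneg fun _ hr => projCosts_nonneg hr))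
    (fun u v => by
      rw [← csInf_add (projCosts_nonempty u) (projCosts_bddBelow u)
        (projCosts_nonempty v) (projCosts_bddBelow v)]
      refine csInf_le_csInf (projCosts_bddBelow _)
        ((projCosts_nonempty u).add (projCosts_nonempty v)) ?_
      rintro _ ⟨r, hr, s, hs, rfl⟩
      exact projCosts_add hr hs)
    (fun k u => by
      rw [← smul_eq_mul, ← Real.sInf_smul_of_nonneg (norm_nonneg k)]
      refine csInf_le_csInf (projCosts_bddBelow _) ((projCosts_nonempty u).smul_set) ?_
      rintro _ ⟨r, hr, rfl⟩
      exact projCosts_smul k hr)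

/-- The algebraic tensor product `A ⊗ B`, to be equipped with the projective norm. -/
def ProjTensor : Type _ := A ⊗[𝕜] B

instance : SeminormedAddCommGroup (ProjTensor 𝕜 A B) :=
  AddGroupSeminorm.toSeminormedAddCommGroup (E := A ⊗[𝕜] B)
    (projSeminorm 𝕜 A B).toAddGroupSeminorm

instance : NormedSpace 𝕜 (ProjTensor 𝕜 A B) :=
  { (inferInstanceAs (Module 𝕜 (A ⊗[𝕜] B)) : Module 𝕜 (A ⊗[𝕜] B)) with
    norm_smul_le := fun k u => (map_smul_eq_mul (projSeminorm 𝕜 A B) k u).le }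

variable {𝕜 A B} in
theorem ProjTensor.norm_def (u : ProjTensor 𝕜 A B) :
    ‖u‖ = sInf (projCosts 𝕜 (u : A ⊗[𝕜] B)) := rfl

/-- The completed projective tensor product `A ⊗̂_π B`, a Banach space over `𝕜`. -/
abbrev ProjTensorCompletion : Type _ := UniformSpace.Completion (ProjTensor 𝕜 A B)

variable {𝕜 A B} in
/-- The element `a ⊗ b` of the algebraic tensor product with the projective norm. -/
def projTmul (a : A) (b : B) : ProjTensor 𝕜 A B := (a ⊗ₜ[𝕜] b : A ⊗[𝕜] B)

end Projective

/-! ### The Hilbert transform and the Hardy space `H¹(ℝ)` -/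

section Hardy

variable {𝕜 : Type*} [RCLike 𝕜]

/-- The truncated Hilbert transform `(1/π) ∫_{|x-y|>ε} g(y)/(x-y) dy`. -/
def truncHilbert (g : ℝ → 𝕜) (ε x : ℝ) : 𝕜 :=
  ((1 / Real.pi : ℝ) : 𝕜) * ∫ y in {y : ℝ | ε < |x - y|}, g y / ((x - y : ℝ) : 𝕜)

/-- `h` is the Hilbert transform of `g`: for almost every `x` the principal value
`(1/π) p.v. ∫ g(y)/(x-y) dy` exists and equals `h x`. -/
def IsHilbertTransform (g h : ℝ → 𝕜) : Prop :=
  ∀ᵐ x : ℝ, Tendsto (fun ε : ℝ => truncHilbert g ε x) (𝓝[>] 0) (𝓝 (h x))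

theorem integrableOn_truncHilbert {g : ℝ → 𝕜} (hg : Integrable g) {ε : ℝ} (hε : 0 < ε) (x : ℝ) :
    IntegrableOn (fun y => g y / ((x - y : ℝ) : 𝕜)) {y : ℝ | ε < |x - y|} := by
  have hs : MeasurableSet {y : ℝ | ε < |x - y|} :=
    measurableSet_lt measurable_const (by fun_prop)
  refine Integrable.mono' (g := fun y => ε⁻¹ * ‖g y‖) (hg.norm.const_mul _).integrableOn ?_ ?_
  · have h1 : AEStronglyMeasurable (fun y : ℝ => (((x - y)⁻¹ : ℝ) : 𝕜)) volume :=
      (RCLike.measurable_ofReal.comp (by fun_prop : Measurable fun y : ℝ => (x - y)⁻¹)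
        ).aestronglyMeasurable
    have h2 := hg.aestronglyMeasurable.mul h1
    refine (h2.congr (ae_of_all _ fun y => ?_)).restrict
    simp [div_eq_mul_inv]
  · refine (ae_restrict_iff' hs).2 (ae_of_all _ fun y hy => ?_)
    have hy' : ε < |x - y| := hy
    rw [norm_div, RCLike.norm_ofReal, div_eq_inv_mul]
    gcongr

theorem truncHilbert_add {g₁ g₂ : ℝ → 𝕜} (h₁ : Integrable g₁) (h₂ : Integrable g₂) {ε : ℝ}
    (hε : 0 < ε) (x : ℝ) :
    truncHilbert (g₁ + g₂) ε x = truncHilbert g₁ ε x + truncHilbert g₂ ε x := by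
  unfold truncHilbert
  rw [← mul_add, ← integral_add (integrableOn_truncHilbert h₁ hε x)
    (integrableOn_truncHilbert h₂ hε x)]
  simp only [Pi.add_apply, add_div]

theorem truncHilbert_smul (k : 𝕜) (g : ℝ → 𝕜) (ε x : ℝ) :
    truncHilbert (k • g) ε x = k * truncHilbert g ε x := by
  unfold truncHilbert
  rw [mul_left_comm]
  congr 1
  rw [← integral_const_mul]
  simp only [Pi.smul_apply, smul_eq_mul, mul_div_assoc]

theorem truncHilbert_congr {g₁ g₂ : ℝ → 𝕜} (h : g₁ =ᵐ[volume] g₂) (ε x : ℝ) :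
    truncHilbert g₁ ε x = truncHilbert g₂ ε x := by
  unfold truncHilbert
  congr 1
  refine integral_congr_ae (ae_restrict_of_ae ?_)
  filter_upwards [h] with y hy
  rw [hy]

variable (𝕜) in
/-- The Hardy space `H¹(ℝ)`: all `g ∈ L¹(ℝ)` with Hilbert transform `Hg ∈ L¹(ℝ)`, with the norm
`‖g‖_{H¹} = ‖g‖₁ + ‖Hg‖₁`. An element `g` is represented by the pair `(g, Hg)`, and the norm is
the `ℓ¹`-norm of the pair. -/
def HardyH1 : Submodule 𝕜 (WithLp 1 (Lp 𝕜 1 (volume : Measure ℝ) × Lp 𝕜 1 (volume : Measure ℝ))) where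
  carrier := {p | IsHilbertTransform (p.fst : ℝ → 𝕜) (p.snd : ℝ → 𝕜)}
  zero_mem' := by
    have h0 : ((0 : Lp 𝕜 1 (volume : Measure ℝ)) : ℝ → 𝕜) =ᵐ[volume] 0 := Lp.coeFn_zero _ _ _
    filter_upwards [h0] with x hx
    have : ∀ ε : ℝ, truncHilbert ((0 : Lp 𝕜 1 (volume : Measure ℝ)) : ℝ → 𝕜) ε x = 0 := by
      intro ε
      rw [truncHilbert_congr h0]
      simp [truncHilbert]
    have h1 : ((0 : WithLp 1 (Lp 𝕜 1 (volume : Measure ℝ) × Lp 𝕜 1 (volume : Measure ℝ)))).snd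
        = 0 := rfl
    have h2 : ((0 : WithLp 1 (Lp 𝕜 1 (volume : Measure ℝ) × Lp 𝕜 1 (volume : Measure ℝ)))).fst
        = 0 := rfl
    rw [h1, h2, hx]
    simp only [this]
    exact tendsto_const_nhds
  add_mem' := by
    intro p q hp hq
    filter_upwards [hp, hq, Lp.coeFn_add p.snd q.snd] with x h1 h2 h3
    simp only [WithLp.add_snd, WithLp.add_fst]
    rw [h3]
    refine (h1.add h2).congr' ?_
    filter_upwards [self_mem_nhdsWithin] with ε hε
    rw [truncHilbert_congr (Lp.coeFn_add p.fst q.fst)]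
    exact (truncHilbert_add (L1.integrable_coeFn _) (L1.integrable_coeFn _) hε x).symm
  smul_mem' := by
    intro k p hp
    filter_upwards [hp, Lp.coeFn_smul k p.snd] with x h1 h3
    simp only [WithLp.smul_snd, WithLp.smul_fst]
    rw [h3]
    refine (h1.const_mul k).congr fun ε => ?_
    rw [truncHilbert_congr (Lp.coeFn_smul k p.fst), truncHilbert_smul]

/-- The function underlying an element of `H¹(ℝ)`. -/
def HardyH1.fn (g : HardyH1 𝕜) : ℝ → 𝕜 := (g.1.fst : ℝ → 𝕜)

/-- Sanity check: the norm of `H¹(ℝ)`. -/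
theorem HardyH1.norm_eq (g : HardyH1 𝕜) :
    ‖g‖ = ‖g.1.fst‖ + ‖g.1.snd‖ :=
  WithLp.prod_norm_eq_of_L1 _

end Hardy

/-! ### The operator `K` and Banach lattices of measurable functions -/

section Operator

variable {𝕜 : Type*} [RCLike 𝕜]

/-- The inner principal value integral `p.v. ∫ F(y₁, y₂) / (x₁ y₂ - x₂ y₁) dy₂` converges to `v`.
The neighbourhood `|x₁ y₂ - x₂ y₁| ≤ ε` of the singularity `y₂ = x₂ y₁ / x₁` that is cut out is
symmetric about it. -/
def HasInnerPV (F : ℝ → ℝ → 𝕜) (x : ℝ × ℝ) (y₁ : ℝ) (v : 𝕜) : Prop :=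
  (∀ ε : ℝ, 0 < ε → IntegrableOn (fun y₂ : ℝ => F y₁ y₂ / ((x.1 * y₂ - x.2 * y₁ : ℝ) : 𝕜))
      {y₂ : ℝ | ε < |x.1 * y₂ - x.2 * y₁|}) ∧
  Tendsto (fun ε : ℝ => ∫ y₂ in {y₂ : ℝ | ε < |x.1 * y₂ - x.2 * y₁|},
      F y₁ y₂ / ((x.1 * y₂ - x.2 * y₁ : ℝ) : 𝕜)) (𝓝[>] 0) (𝓝 v)

/-- `(K F)(x₁, x₂) = (1/π) ∫ (p.v. ∫ F(y₁, y₂) / (x₁ y₂ - x₂ y₁) dy₂) dy₁` exists at `x` and equals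
`v`: the inner integral exists as a principal value for almost every `y₁`, and the outer one
converges absolutely. -/
def HasK (F : ℝ → ℝ → 𝕜) (x : ℝ × ℝ) (v : 𝕜) : Prop :=
  ∃ I : ℝ → 𝕜, (∀ᵐ y₁ : ℝ, HasInnerPV F x y₁ (I y₁)) ∧ Integrable I ∧
    v = ((1 / Real.pi : ℝ) : 𝕜) * ∫ y₁, I y₁

/-- The normed space `E`, embedded by `ι` into the space of (`μ`-a.e. classes of) measurable
functions on the plane, is a Banach lattice of measurable functions: `E` is complete, and if `f` is
measurable, `g ∈ E` and `|f| ≤ |g|` a.e., then `f ∈ E` and `‖f‖ ≤ ‖g‖`. -/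
structure IsBanachFunctionLattice {μ : Measure (ℝ × ℝ)} {E : Type*} [NormedAddCommGroup E]
    [NormedSpace 𝕜 E] (ι : E →ₗ[𝕜] (ℝ × ℝ →ₘ[μ] 𝕜)) : Prop where
  complete : CompleteSpace E
  injective : Function.Injective ι
  solid : ∀ (f : ℝ × ℝ →ₘ[μ] 𝕜) (g : E), (∀ᵐ x ∂μ, ‖f x‖ ≤ ‖ι g x‖) →
    ∃ f' : E, ι f' = f ∧ ‖f'‖ ≤ ‖g‖

/-- A linear map `T` on `L^∞(ℝ) ⊗̂_π H¹(ℝ)` with values in `E` extends `K`: on a function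
`F(y₁, y₂) = ∑ fᵢ(y₁) gᵢ(y₂)` of the algebraic tensor product, `T F` is the function `K F` given
by the principal value integral. -/
def ExtendsK {μ : Measure (ℝ × ℝ)} {E : Type*} [NormedAddCommGroup E] [NormedSpace 𝕜 E]
    (ι : E →ₗ[𝕜] (ℝ × ℝ →ₘ[μ] 𝕜))
    (T : ProjTensorCompletion 𝕜 (Lp 𝕜 ∞ (volume : Measure ℝ)) (HardyH1 𝕜) →L[𝕜] E) : Prop :=
  ∀ (n : ℕ) (f : Fin n → Lp 𝕜 ∞ (volume : Measure ℝ)) (g : Fin n → HardyH1 𝕜),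
    ∀ᵐ x ∂μ, HasK (fun y₁ y₂ => ∑ i, f i y₁ * HardyH1.fn (g i) y₂) x
      (ι (T (∑ i, projTmul (𝕜 := 𝕜) (f i) (g i) : ProjTensor 𝕜 _ _)) x)

end Operator

end

/-! Writing `x₁ y₂ - x₂ y₁ = -x₁ (z - y₂)` with `z = x₂ y₁ / x₁` turns the inner principal value for
`f ⊗ g` into a Hilbert transform at `z`. Off the axes this gives `K (f ⊗ g)(x) = -x₁⁻¹ ∫ f(y) Hg(x₂
y / x₁) dy`, called `dilationPairing` below. Substituting `t = x₂ y / x₁` produces the factor `|x₁ /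
x₂|`, which cancels `|x₁|⁻¹` and leaves the bound `‖f‖_∞ ‖Hg‖₁ |x₂|⁻¹` (`hasK_dilationPairing`,
`norm_dilationPairing_le`).

Thus `K (f ⊗ g)` is dominated by a multiple of `w`. Solidity puts it in `E` with norm at most `‖w‖
‖f‖ ‖g‖`. The resulting bounded bilinear map extends to the completed projective tensor product with
the same constant (`exists_projTensorCompletion_lift`). Uniqueness follows from density of the
algebraic tensors and from the fact that `HasK` determines its value. -/

/-! ### Universal property of the projective tensor product. -/

section ProjectiveLift

variable {𝕜 A B G : Type*} [RCLike 𝕜] [NormedAddCommGroup A] [NormedSpace 𝕜 A]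
  [NormedAddCommGroup B] [NormedSpace 𝕜 B] [NormedAddCommGroup G] [NormedSpace 𝕜 G]

/-- The bounded linear map on the projective tensor product induced by a bounded bilinear map. -/
noncomputable def projLift (b : A →ₗ[𝕜] B →ₗ[𝕜] G) (C : ℝ)
    (hb : ∀ x y, ‖b x y‖ ≤ C * (‖x‖ * ‖y‖)) (hC : 0 ≤ C) : ProjTensor 𝕜 A B →L[𝕜] G :=
  LinearMap.mkContinuous (E := ProjTensor 𝕜 A B)
    { toFun := fun u => TensorProduct.lift b u
      map_add' := fun u v => map_add (TensorProduct.lift b) u v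
      map_smul' := fun k u => map_smul (TensorProduct.lift b) k u } C (fun u => by
    -- With `C ≥ 0` moved inside the infimum, it suffices to bound the image by `C` times the cost
    -- of each single representation.
    rw [ProjTensor.norm_def, ← smul_eq_mul, ← Real.sInf_smul_of_nonneg hC]
    refine le_csInf (projCosts_nonempty (𝕜 := 𝕜) (A := A) (B := B) u).smul_set ?_
    rintro _ ⟨_, ⟨n, x, y, hu, rfl⟩, rfl⟩
    change ‖TensorProduct.lift b u‖ ≤ C • ∑ i, ‖x i‖ * ‖y i‖
    rw [hu, map_sum, smul_eq_mul, Finset.mul_sum]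
    exact norm_sum_le_of_le _ fun i _ => by simpa using hb (x i) (y i))

theorem projLift_projTmul (b : A →ₗ[𝕜] B →ₗ[𝕜] G) (C : ℝ)
    (hb : ∀ x y, ‖b x y‖ ≤ C * (‖x‖ * ‖y‖)) (hC : 0 ≤ C) (x : A) (y : B) :
    projLift b C hb hC (projTmul x y) = b x y :=
  TensorProduct.lift.tmul x y

theorem norm_projLift_le (b : A →ₗ[𝕜] B →ₗ[𝕜] G) (C : ℝ)
    (hb : ∀ x y, ‖b x y‖ ≤ C * (‖x‖ * ‖y‖)) (hC : 0 ≤ C) : ‖projLift b C hb hC‖ ≤ C :=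
  LinearMap.mkContinuous_norm_le _ hC _

theorem exists_eq_sum_projTmul (u : ProjTensor 𝕜 A B) :
    ∃ (n : ℕ) (x : Fin n → A) (y : Fin n → B), u = ∑ i, projTmul (𝕜 := 𝕜) (x i) (y i) := by
  obtain ⟨_, n, x, y, hu, -⟩ := projCosts_nonempty (𝕜 := 𝕜) (A := A) (B := B) u
  exact ⟨n, x, y, hu⟩

/-- A bounded bilinear map into a Banach space extends to the completed projective tensor product
with the same bound. -/
theorem exists_projTensorCompletion_lift [CompleteSpace G] (b : A →ₗ[𝕜] B →ₗ[𝕜] G) (C : ℝ)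
    (hb : ∀ x y, ‖b x y‖ ≤ C * (‖x‖ * ‖y‖)) (hC : 0 ≤ C) :
    ∃ T : ProjTensorCompletion 𝕜 A B →L[𝕜] G,
      (∀ (n : ℕ) (x : Fin n → A) (y : Fin n → B),
        T (∑ i, projTmul (𝕜 := 𝕜) (x i) (y i) : ProjTensor 𝕜 A B) = ∑ i, b (x i) (y i)) ∧
      ‖T‖ ≤ C := by
  let j : ProjTensor 𝕜 A B →L[𝕜] ProjTensorCompletion 𝕜 A B := UniformSpace.Completion.toComplL
  have hj : DenseRange j := UniformSpace.Completion.denseRange_coe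
  have hj' : IsUniformInducing j := UniformSpace.Completion.isUniformInducing_coe _
  have hext : ∀ u : ProjTensor 𝕜 A B, (projLift b C hb hC).extend j u = projLift b C hb hC u :=
    fun u => ContinuousLinearMap.extend_eq (projLift b C hb hC) hj hj' u
  refine ⟨(projLift b C hb hC).extend j, fun n x y => ?_, ?_⟩
  · rw [hext, map_sum]
    exact Finset.sum_congr rfl fun i _ => projLift_projTmul b C hb hC _ _
  · refine ContinuousLinearMap.opNorm_le_bound _ hC fun u => ?_
    -- The bound is a closed condition, so it only has to be checked on the dense image of the
    -- algebraic tensor product.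
    refine UniformSpace.Completion.induction_on u
      (isClosed_le (by fun_prop) (by fun_prop)) fun u => ?_
    rw [hext, UniformSpace.Completion.norm_coe]
    exact (projLift b C hb hC).le_of_opNorm_le (norm_projLift_le b C hb hC) u

end ProjectiveLift

/-! ### Linearity and uniqueness of the iterated principal value. -/

section Kernel

variable {𝕜 : Type*} [RCLike 𝕜]

theorem HasInnerPV.add {F G : ℝ → ℝ → 𝕜} {x : ℝ × ℝ} {y : ℝ} {v w : 𝕜}
    (hF : HasInnerPV F x y v) (hG : HasInnerPV G x y w) :
    HasInnerPV (fun y₁ y₂ => F y₁ y₂ + G y₁ y₂) x y (v + w) := by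
  refine ⟨fun ε hε => ?_, (hF.2.add hG.2).congr' ?_⟩
  · simp only [add_div]
    exact (hF.1 ε hε).add (hG.1 ε hε)
  · filter_upwards [self_mem_nhdsWithin] with ε hε
    simp only [add_div]
    exact (integral_add (hF.1 ε hε) (hG.1 ε hε)).symm

theorem HasK.add {F G : ℝ → ℝ → 𝕜} {x : ℝ × ℝ} {v w : 𝕜}
    (hF : HasK F x v) (hG : HasK G x w) :
    HasK (fun y₁ y₂ => F y₁ y₂ + G y₁ y₂) x (v + w) := by
  obtain ⟨I, hI, hI', rfl⟩ := hF
  obtain ⟨J, hJ, hJ', rfl⟩ := hG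
  refine ⟨I + J, ?_, hI'.add hJ', ?_⟩
  · filter_upwards [hI, hJ] with y h₁ h₂ using h₁.add h₂
  · rw [integral_add' hI' hJ', mul_add]

theorem HasK.zero (x : ℝ × ℝ) : HasK (fun _ _ => (0 : 𝕜)) x 0 :=
  ⟨0, ae_of_all _ fun y => ⟨by simp, by simp⟩, integrable_zero _ _ _, by simp⟩

theorem HasK.sum {α : Type*} (s : Finset α) {F : α → ℝ → ℝ → 𝕜} {x : ℝ × ℝ} {v : α → 𝕜}
    (h : ∀ i ∈ s, HasK (F i) x (v i)) :
    HasK (fun y₁ y₂ => ∑ i ∈ s, F i y₁ y₂) x (∑ i ∈ s, v i) := by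
  classical
  induction s using Finset.induction_on with
  | empty => simpa using HasK.zero x
  | insert a s ha ih =>
    simp only [Finset.sum_insert ha]
    exact (h a (by simp)).add (ih fun i hi => h i (by simp [hi]))

/-- Limits are unique, so two admissible inner integrals agree for almost every `y₁` and have the
same outer integral. -/
theorem HasK.unique {F : ℝ → ℝ → 𝕜} {x : ℝ × ℝ} {v w : 𝕜}
    (hv : HasK F x v) (hw : HasK F x w) : v = w := by
  obtain ⟨I, hI, -, rfl⟩ := hv
  obtain ⟨J, hJ, -, rfl⟩ := hw
  congr 1
  refine integral_congr_ae ?_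
  filter_upwards [hI, hJ] with y h₁ h₂ using tendsto_nhds_unique h₁.2 h₂.2

/-! ### The kernel on elementary tensors: dilations and the Hilbert transform. -/

/-- Transfers almost-everywhere statements about `Hg` to the point `x₂ y / x₁`. -/
theorem quasiMeasurePreserving_const_mul {c : ℝ} (hc : c ≠ 0) :
    Measure.QuasiMeasurePreserving (fun y : ℝ => c * y) volume volume :=
  ⟨measurable_const_mul c, by
    rw [Real.map_volume_mul_left hc]
    exact Measure.smul_absolutelyContinuous⟩

/-- For `h = Hg` this is the value of `K (f ⊗ g)` at `x`. -/
noncomputable def dilationPairing (f h : ℝ → 𝕜) (x : ℝ × ℝ) : 𝕜 :=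
  -((x.1 : 𝕜)⁻¹) * ∫ y, f y * h (x.2 / x.1 * y)

theorem stronglyMeasurable_dilationPairing {f h : ℝ → 𝕜} (hf : StronglyMeasurable f)
    (hh : StronglyMeasurable h) : StronglyMeasurable (dilationPairing f h) := by
  have h1 : Measurable fun x : ℝ × ℝ => -((x.1 : 𝕜)⁻¹) :=
    (RCLike.measurable_ofReal.comp measurable_fst).inv.neg
  refine h1.stronglyMeasurable.mul ?_
  refine StronglyMeasurable.integral_prod_right
    (f := fun (x : ℝ × ℝ) (y : ℝ) => f y * h (x.2 / x.1 * y)) ?_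
  exact (hf.comp_measurable measurable_snd).mul (hh.comp_measurable (by fun_prop))

theorem ae_norm_le_norm_Lp_top (f : Lp 𝕜 ∞ (volume : Measure ℝ)) : ∀ᵐ y, ‖f y‖ ≤ ‖f‖ := by
  filter_upwards [enorm_ae_le_eLpNormEssSup (f : ℝ → 𝕜) volume] with y hy
  rw [Lp.norm_def, ← toReal_enorm]
  refine ENNReal.toReal_mono (Lp.eLpNorm_ne_top f) ?_
  rwa [eLpNorm_exponent_top]

theorem integrable_mul_dilation (f : Lp 𝕜 ∞ (volume : Measure ℝ)) {h : ℝ → 𝕜}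
    (hh : Integrable h) {c : ℝ} (hc : c ≠ 0) : Integrable fun y => f y * h (c * y) :=
  (hh.comp_mul_left' hc).bdd_mul (Lp.aestronglyMeasurable f) (ae_norm_le_norm_Lp_top f)

/-- Hölder's inequality and scaling: the dilation multiplies `‖h‖₁` by `|x₁ / x₂|`, and the
prefactor `|x₁|⁻¹` removes the dependence on `x₁`. -/
theorem norm_dilationPairing_le (f : Lp 𝕜 ∞ (volume : Measure ℝ))
    (h : Lp 𝕜 1 (volume : Measure ℝ)) {x : ℝ × ℝ} (hx₁ : x.1 ≠ 0) (hx₂ : x.2 ≠ 0) :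
    ‖dilationPairing f h x‖ ≤ ‖f‖ * ‖h‖ * |x.2|⁻¹ := by
  have hc : x.2 / x.1 ≠ 0 := div_ne_zero hx₂ hx₁
  have hh := L1.integrable_coeFn h
  have key : ‖∫ y, f y * h (x.2 / x.1 * y)‖ ≤ ‖f‖ * (|(x.2 / x.1)⁻¹| * ‖h‖) := by
    calc ‖∫ y, f y * h (x.2 / x.1 * y)‖ ≤ ∫ y, ‖f y * h (x.2 / x.1 * y)‖ :=
          norm_integral_le_integral_norm _
      _ ≤ ∫ y, ‖f‖ * ‖h (x.2 / x.1 * y)‖ := by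
          refine integral_mono_ae (integrable_mul_dilation f hh hc).norm
            ((hh.comp_mul_left' hc).norm.const_mul _) ?_
          filter_upwards [ae_norm_le_norm_Lp_top f] with y hy
          rw [norm_mul]
          gcongr
      _ = ‖f‖ * (|(x.2 / x.1)⁻¹| * ‖h‖) := by
          rw [integral_const_mul, Measure.integral_comp_mul_left (fun y => ‖h y‖),
            L1.norm_eq_integral_norm, smul_eq_mul]
  rw [dilationPairing, norm_mul, norm_neg, norm_inv, RCLike.norm_ofReal]
  calc |x.1|⁻¹ * ‖∫ y, f y * h (x.2 / x.1 * y)‖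
      ≤ |x.1|⁻¹ * (‖f‖ * (|(x.2 / x.1)⁻¹| * ‖h‖)) := by gcongr
    _ = ‖f‖ * ‖h‖ * |x.2|⁻¹ := by
      have := abs_ne_zero.2 hx₁
      have := abs_ne_zero.2 hx₂
      rw [inv_div, abs_div]
      field_simp

/-- The change of form `x₁ y₂ - x₂ y = -x₁ (z - y₂)` accounts for the sign and for `x₁⁻¹`. The
factor `π` undoes the normalisation in `truncHilbert` and is cancelled later by the `1/π` in `HasK`.
-/
theorem hasInnerPV_mul {f g h : ℝ → 𝕜} (hg : Integrable g) {x : ℝ × ℝ} (hx₁ : x.1 ≠ 0) {y : ℝ}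
    (hy : Tendsto (fun ε : ℝ => truncHilbert g ε (x.2 / x.1 * y)) (𝓝[>] 0)
      (𝓝 (h (x.2 / x.1 * y)))) :
    HasInnerPV (fun y₁ y₂ => f y₁ * g y₂) x y
      (-((x.1 : 𝕜)⁻¹) * Real.pi * (f y * h (x.2 / x.1 * y))) := by
  set z := x.2 / x.1 * y with hz
  have habs : 0 < |x.1| := abs_pos.2 hx₁
  have hx₁' : (x.1 : 𝕜) ≠ 0 := RCLike.ofReal_ne_zero.2 hx₁
  have hpi : (Real.pi : 𝕜) ≠ 0 := RCLike.ofReal_ne_zero.2 Real.pi_ne_zero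
  have hden : ∀ y₂, x.1 * y₂ - x.2 * y = -x.1 * (z - y₂) := fun y₂ => by
    rw [hz]; field_simp; ring
  have hset : ∀ ε : ℝ, {y₂ : ℝ | ε < |x.1 * y₂ - x.2 * y|} =
      {y₂ : ℝ | ε / |x.1| < |z - y₂|} := fun ε => by
    ext y₂
    simp only [Set.mem_ofPred_eq]
    rw [hden, abs_mul, abs_neg, div_lt_iff₀' habs]
  have hfun : ∀ y₂, f y * g y₂ / ((x.1 * y₂ - x.2 * y : ℝ) : 𝕜) =
      (-((x.1 : 𝕜)⁻¹) * f y) * (g y₂ / ((z - y₂ : ℝ) : 𝕜)) := fun y₂ => by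
    rw [hden, RCLike.ofReal_mul, RCLike.ofReal_neg, neg_mul, div_neg, mul_div_mul_comm,
      div_eq_mul_inv (f y)]
    ring
  constructor
  · intro ε hε
    simp only [hset, hfun]
    exact (integrableOn_truncHilbert hg (div_pos hε habs) z).const_mul _
  -- Cutting at `ε` in the kernel's denominator means cutting at `ε / |x₁|` around `z`, and this
  -- rescaling preserves the limit at `0⁺`.
  · have hlim : Tendsto (fun ε : ℝ => ε / |x.1|) (𝓝[>] 0) (𝓝[>] 0) := by
      refine tendsto_nhdsWithin_iff.2 ⟨?_, ?_⟩
      · have : Tendsto (fun ε : ℝ => ε / |x.1|) (𝓝 0) (𝓝 (0 / |x.1|)) :=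
          tendsto_id.div_const _
        rw [zero_div] at this
        exact this.mono_left nhdsWithin_le_nhds
      · filter_upwards [self_mem_nhdsWithin] with ε hε using div_pos hε habs
    have := (hy.comp hlim).const_mul (-((x.1 : 𝕜)⁻¹) * Real.pi * f y)
    rw [← mul_assoc]
    refine this.congr fun ε => ?_
    simp only [hset, hfun, Function.comp_apply, truncHilbert]
    rw [integral_const_mul, RCLike.ofReal_div, RCLike.ofReal_one]
    field_simp

theorem hasK_dilationPairing (f : Lp 𝕜 ∞ (volume : Measure ℝ)) (g : HardyH1 𝕜) {x : ℝ × ℝ}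
    (hx₁ : x.1 ≠ 0) (hx₂ : x.2 ≠ 0) :
    HasK (fun y₁ y₂ => f y₁ * HardyH1.fn g y₂) x (dilationPairing f g.1.snd x) := by
  have hc : x.2 / x.1 ≠ 0 := div_ne_zero hx₂ hx₁
  have hpi : (Real.pi : 𝕜) ≠ 0 := RCLike.ofReal_ne_zero.2 Real.pi_ne_zero
  refine ⟨fun y => -((x.1 : 𝕜)⁻¹) * Real.pi * (f y * (g.1.snd : ℝ → 𝕜) (x.2 / x.1 * y)),
    ?_, ?_, ?_⟩
  · have hg : IsHilbertTransform (g.1.fst : ℝ → 𝕜) (g.1.snd : ℝ → 𝕜) := g.2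
    filter_upwards [(quasiMeasurePreserving_const_mul hc).ae hg] with y hy
    exact hasInnerPV_mul (L1.integrable_coeFn _) hx₁ hy
  · exact (integrable_mul_dilation f (L1.integrable_coeFn _) hc).const_mul _
  · rw [integral_const_mul, dilationPairing, RCLike.ofReal_div, RCLike.ofReal_one]
    field_simp

/-- Off the axes the dilation is nondegenerate, so the pairing depends only on almost-everywhere
classes. This is what makes it bilinear on `Lp` classes. -/
theorem dilationPairing_congr {f f' h h' : ℝ → 𝕜} (hf : f =ᵐ[volume] f') (hh : h =ᵐ[volume] h')
    {x : ℝ × ℝ} (hx₁ : x.1 ≠ 0) (hx₂ : x.2 ≠ 0) :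
    dilationPairing f h x = dilationPairing f' h' x := by
  unfold dilationPairing
  congr 1
  refine integral_congr_ae ?_
  filter_upwards [hf, (quasiMeasurePreserving_const_mul (div_ne_zero hx₂ hx₁)).ae hh]
    with y h₁ h₂
  rw [h₁, h₂]

theorem dilationPairing_add_left (f f' : Lp 𝕜 ∞ (volume : Measure ℝ))
    (h : Lp 𝕜 1 (volume : Measure ℝ)) {x : ℝ × ℝ} (hx₁ : x.1 ≠ 0) (hx₂ : x.2 ≠ 0) :
    dilationPairing ⇑(f + f') h x = dilationPairing f h x + dilationPairing f' h x := by
  have hc : x.2 / x.1 ≠ 0 := div_ne_zero hx₂ hx₁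
  have hh := L1.integrable_coeFn h
  rw [dilationPairing_congr (Lp.coeFn_add f f') EventuallyEq.rfl hx₁ hx₂]
  simp only [dilationPairing, Pi.add_apply, add_mul]
  rw [integral_add (integrable_mul_dilation f hh hc) (integrable_mul_dilation f' hh hc), mul_add]

theorem dilationPairing_add_right (f : Lp 𝕜 ∞ (volume : Measure ℝ))
    (h h' : Lp 𝕜 1 (volume : Measure ℝ)) {x : ℝ × ℝ} (hx₁ : x.1 ≠ 0) (hx₂ : x.2 ≠ 0) :
    dilationPairing f ⇑(h + h') x = dilationPairing f h x + dilationPairing f h' x := by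
  have hc : x.2 / x.1 ≠ 0 := div_ne_zero hx₂ hx₁
  rw [dilationPairing_congr EventuallyEq.rfl (Lp.coeFn_add h h') hx₁ hx₂]
  simp only [dilationPairing, Pi.add_apply, mul_add]
  rw [integral_add (integrable_mul_dilation f (L1.integrable_coeFn h) hc)
    (integrable_mul_dilation f (L1.integrable_coeFn h') hc), mul_add]

theorem dilationPairing_smul_left (k : 𝕜) (f : Lp 𝕜 ∞ (volume : Measure ℝ))
    (h : Lp 𝕜 1 (volume : Measure ℝ)) {x : ℝ × ℝ} (hx₁ : x.1 ≠ 0) (hx₂ : x.2 ≠ 0) :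
    dilationPairing ⇑(k • f) h x = k * dilationPairing f h x := by
  rw [dilationPairing_congr (Lp.coeFn_smul k f) EventuallyEq.rfl hx₁ hx₂]
  simp only [dilationPairing, Pi.smul_apply, smul_eq_mul, mul_assoc]
  rw [integral_const_mul]
  ring

theorem dilationPairing_smul_right (k : 𝕜) (f : Lp 𝕜 ∞ (volume : Measure ℝ))
    (h : Lp 𝕜 1 (volume : Measure ℝ)) {x : ℝ × ℝ} (hx₁ : x.1 ≠ 0) (hx₂ : x.2 ≠ 0) :
    dilationPairing f ⇑(k • h) x = k * dilationPairing f h x := by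
  rw [dilationPairing_congr EventuallyEq.rfl (Lp.coeFn_smul k h) hx₁ hx₂]
  simp only [dilationPairing, Pi.smul_apply, smul_eq_mul, mul_left_comm _ k]
  rw [integral_const_mul]
  ring

/-! ### Passage to the lattice and uniqueness of the extension. -/

theorem exists_lattice_dilationPairing {μ : Measure (ℝ × ℝ)} (hμ : ∀ᵐ x ∂μ, x.1 ≠ 0 ∧ x.2 ≠ 0)
    {E : Type*} [NormedAddCommGroup E] [NormedSpace 𝕜 E] {ι : E →ₗ[𝕜] (ℝ × ℝ →ₘ[μ] 𝕜)}
    (hE : IsBanachFunctionLattice ι)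
    {w : E} (hw : ∀ᵐ x ∂μ, ι w x = ((|x.2|⁻¹ : ℝ) : 𝕜))
    (f : Lp 𝕜 ∞ (volume : Measure ℝ)) (g : HardyH1 𝕜) :
    ∃ e : E, (∀ᵐ x ∂μ, ι e x = dilationPairing f g.1.snd x) ∧ ‖e‖ ≤ ‖w‖ * (‖f‖ * ‖g‖) := by
  set D := AEEqFun.mk (μ := μ) (dilationPairing f g.1.snd) (stronglyMeasurable_dilationPairing
    (Lp.stronglyMeasurable f) (Lp.stronglyMeasurable g.1.snd)).aestronglyMeasurable
  have hD : ∀ᵐ x ∂μ, D x = dilationPairing f g.1.snd x := AEEqFun.coeFn_mk _ _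
  -- The pointwise bound involves only `‖Hg‖₁`, so `c • w` is the dominating element; `‖Hg‖₁ ≤ ‖g‖`
  -- is used only at the end.
  set c : ℝ := ‖f‖ * ‖g.1.snd‖
  have hc : 0 ≤ c := by positivity
  have hcw : ∀ᵐ x ∂μ, ι ((c : 𝕜) • w) x = (c : 𝕜) * ι w x := by
    rw [map_smul]
    exact AEEqFun.coeFn_smul _ _
  obtain ⟨e, he, hle⟩ := hE.solid D ((c : 𝕜) • w) (by
    filter_upwards [hD, hcw, hw, hμ] with x h₁ h₂ h₃ h₄
    rw [h₁, h₂, h₃, norm_mul, RCLike.norm_ofReal, RCLike.norm_ofReal, abs_of_nonneg hc, abs_inv,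
      abs_abs]
    exact norm_dilationPairing_le f _ h₄.1 h₄.2)
  refine ⟨e, he ▸ hD, hle.trans ?_⟩
  rw [norm_smul, RCLike.norm_ofReal, abs_of_nonneg hc, mul_comm]
  refine mul_le_mul_of_nonneg_left ?_ (norm_nonneg w)
  refine mul_le_mul_of_nonneg_left ?_ (norm_nonneg f)
  rw [HardyH1.norm_eq]
  exact le_add_of_nonneg_left (norm_nonneg g.1.fst)

theorem exists_bilinear_dilationPairing {μ : Measure (ℝ × ℝ)}
    (hμ : ∀ᵐ x ∂μ, x.1 ≠ 0 ∧ x.2 ≠ 0)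
    {E : Type*} [NormedAddCommGroup E] [NormedSpace 𝕜 E] {ι : E →ₗ[𝕜] (ℝ × ℝ →ₘ[μ] 𝕜)}
    (hE : IsBanachFunctionLattice ι)
    {w : E} (hw : ∀ᵐ x ∂μ, ι w x = ((|x.2|⁻¹ : ℝ) : 𝕜)) :
    ∃ b : Lp 𝕜 ∞ (volume : Measure ℝ) →ₗ[𝕜] HardyH1 𝕜 →ₗ[𝕜] E, ∀ f g,
      (∀ᵐ x ∂μ, ι (b f g) x = dilationPairing f g.1.snd x) ∧
        ‖b f g‖ ≤ ‖w‖ * (‖f‖ * ‖g‖) := by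
  -- The chosen elements are bilinear although chosen separately: `ι` is injective, so the
  -- identities can be checked almost everywhere on functions.
  choose e he hle using exists_lattice_dilationPairing hμ hE hw
  refine ⟨LinearMap.mk₂ 𝕜 e ?_ ?_ ?_ ?_, fun f g => ⟨he f g, hle f g⟩⟩
  · intro f f' g
    apply hE.injective
    rw [map_add]
    refine AEEqFun.ext ?_
    filter_upwards [he (f + f') g, he f g, he f' g, AEEqFun.coeFn_add (ι (e f g)) (ι (e f' g)),
      hμ] with x h₁ h₂ h₃ h₄ hx
    rw [h₁, h₄, Pi.add_apply, h₂, h₃, dilationPairing_add_left _ _ _ hx.1 hx.2]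
  · intro k f g
    apply hE.injective
    rw [map_smul]
    refine AEEqFun.ext ?_
    filter_upwards [he (k • f) g, he f g, AEEqFun.coeFn_smul k (ι (e f g)), hμ]
      with x h₁ h₂ h₄ hx
    rw [h₁, h₄, Pi.smul_apply, h₂, dilationPairing_smul_left _ _ _ hx.1 hx.2, smul_eq_mul]
  · intro f g g'
    apply hE.injective
    rw [map_add]
    refine AEEqFun.ext ?_
    filter_upwards [he f (g + g'), he f g, he f g', AEEqFun.coeFn_add (ι (e f g)) (ι (e f g')),
      hμ] with x h₁ h₂ h₃ h₄ hx
    rw [h₁, h₄, Pi.add_apply, h₂, h₃, ← dilationPairing_add_right _ _ _ hx.1 hx.2]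
    rfl
  · intro k f g
    apply hE.injective
    rw [map_smul]
    refine AEEqFun.ext ?_
    filter_upwards [he f (k • g), he f g, AEEqFun.coeFn_smul k (ι (e f g)), hμ]
      with x h₁ h₂ h₄ hx
    rw [h₁, h₄, Pi.smul_apply, h₂, smul_eq_mul, ← dilationPairing_smul_right _ _ _ hx.1 hx.2]
    rfl

theorem AEEqFun.coeFn_finset_sum {X ι : Type*} [MeasurableSpace X] {μ : Measure X}
    (s : Finset ι) (F : ι → X →ₘ[μ] 𝕜) :
    ∀ᵐ x ∂μ, (∑ i ∈ s, F i) x = ∑ i ∈ s, F i x := by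
  classical
  induction s using Finset.induction_on with
  | empty =>
    filter_upwards [AEEqFun.coeFn_zero (μ := μ) (β := 𝕜)] with x hx
    simpa using hx
  | insert a s ha ih =>
    rw [Finset.sum_insert ha]
    filter_upwards [ih, AEEqFun.coeFn_add (F a) (∑ i ∈ s, F i)] with x h₁ h₂
    rw [h₂, Pi.add_apply, h₁, Finset.sum_insert ha]

/-- Two bounded operators which extend `K` coincide. -/
theorem ExtendsK.unique {μ : Measure (ℝ × ℝ)} {E : Type*} [NormedAddCommGroup E]
    [NormedSpace 𝕜 E] {ι : E →ₗ[𝕜] (ℝ × ℝ →ₘ[μ] 𝕜)} (hι : Function.Injective ι)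
    {T T' : ProjTensorCompletion 𝕜 (Lp 𝕜 ∞ (volume : Measure ℝ)) (HardyH1 𝕜) →L[𝕜] E}
    (hT : ExtendsK ι T) (hT' : ExtendsK ι T') : T' = T := by
  ext u
  -- By continuity it suffices to compare the operators on finite sums of elementary tensors, where
  -- both give the value fixed by `HasK`.
  refine UniformSpace.Completion.induction_on u (isClosed_eq T'.continuous T.continuous)
    fun u => ?_
  obtain ⟨n, f, g, rfl⟩ := exists_eq_sum_projTmul u
  apply hι
  refine AEEqFun.ext ?_
  filter_upwards [hT n f g, hT' n f g] with x h₁ h₂ using h₂.unique h₁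

end Kernel

set_option maxHeartbeats 1000000 in
theorem mainTheorem5 {𝕜 : Type*} [RCLike 𝕜] (μ : Measure (ℝ × ℝ))
    (hμ : ∀ᵐ x ∂μ, x.1 ≠ 0 ∧ x.2 ≠ 0)
    {E : Type*} [NormedAddCommGroup E] [NormedSpace 𝕜 E] (ι : E →ₗ[𝕜] (ℝ × ℝ →ₘ[μ] 𝕜))
    (hE : IsBanachFunctionLattice ι)
    (w : E) (hw : ∀ᵐ x ∂μ, ι w x = ((|x.2|⁻¹ : ℝ) : 𝕜)) :
    ∃ T : ProjTensorCompletion 𝕜 (Lp 𝕜 ∞ (volume : Measure ℝ)) (HardyH1 𝕜) →L[𝕜] E,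
      ExtendsK ι T ∧
      (∀ T' : ProjTensorCompletion 𝕜 (Lp 𝕜 ∞ (volume : Measure ℝ)) (HardyH1 𝕜) →L[𝕜] E,
        ExtendsK ι T' → T' = T) ∧
      ‖T‖ ≤ ‖w‖ := by
  have := hE.complete
  obtain ⟨b, hb⟩ := exists_bilinear_dilationPairing hμ hE hw
  have hb' : ∀ f g, ‖b f g‖ ≤ ‖w‖ * (‖f‖ * ‖g‖) := fun f g => (hb f g).2
  obtain ⟨T, hval, hnorm⟩ := exists_projTensorCompletion_lift (𝕜 := 𝕜)
    (A := Lp 𝕜 ∞ (volume : Measure ℝ)) (B := HardyH1 𝕜) (G := E) b ‖w‖ hb' (norm_nonneg w)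
  have hT : ExtendsK ι T := by
    intro n f g
    rw [hval, map_sum]
    filter_upwards [AEEqFun.coeFn_finset_sum Finset.univ fun i => ι (b (f i) (g i)), hμ,
      ae_all_iff.2 fun i => (hb (f i) (g i)).1] with x h₁ hx h₂
    rw [h₁]
    refine HasK.sum _ fun i _ => ?_
    rw [h₂ i]
    exact hasK_dilationPairing (f i) (g i) hx.1 hx.2
  exact ⟨T, hT, fun T' hT' => hT.unique hE.injective hT', hnorm⟩
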